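/- Let $m\ge 0$ be an integer. On words over the alphabet $\{a,b\}$ let $h$ be the additive valuation with $h(a)=2m+1$ and $h(b)=-2$. A word $w$ is a generalized Dyck word (of slope $\frac{2m+1}{2}$) if $h(w)=0$ and $h(w_1)\ge 0$ for every prefix $w_1$ of $w$; it is factor-free if it has no nonempty proper factor (that is, no nonempty contiguous subword other than $w$ itself) that is a generalized Dyck word. For $n\ge 1$ let $\theta_n$ be the number of factor-free generalized Dyck words of length $(2m+3)n$. Then the generating function $\sum_w \tau^{|w|}$ over all factor-free generalized Dyck words $w$ (including the empty word), where $|w|$ is the length of $w$, equals $\mathcal D(\tau^{2m+3})$ with $$\mathcal D(t)=1+\sum_{n\ge 1}\theta_n t^n,$$ and for every $n\ge 1$ $$\theta_n=\sum_{\ell=0}^{\min(m,n-1)}\binom{m+\ell+1}{m-\ell}\,\Delta_{n-\ell-1,\ell},$$ where $$\Delta_{\nu,\ell}=\frac{2\ell+1}{2\nu+2\ell+1}\sum_{k=0}^{\nu}\binom{2\nu+2\ell+1}{k}\frac{k!}{\nu!}\,B_{\nu,k}(1!\mu_1,2!\mu_2,\dots),$$ $\mu_j=\binom{m+j}{m-j}$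 for $1\le j\le m$, $\mu_j=0$ for $j>m$, and $B_{n,k}$ denotes the partial Bell polynomial $$B_{n,k}(z_1,z_2,\dots)=\sum\frac{n!}{j_1!\,j_2!\cdots}\Big(\frac{z_1}{1!}\Big)^{j_1}\Big(\frac{z_2}{2!}\Big)^{j_2}\cdots,$$ the sum being over all integers $j_1,j_2,\dots\ge 0$ with $\sum_i j_i=k$ and $\sum_i i\,j_i=n$. -/

import Mathlib

namespace FactorFreeDyck

/-- The two-letter alphabet `{a, b}`. -/
inductive Letter
  | a
  | b
  deriving DecidableEq

instance : Fintype Letter :=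
  ⟨{Letter.a, Letter.b}, fun x => by cases x <;> simp⟩

/-- The valuation `h(w)` of a word, extended additively from the letters. -/
def valuation {α : Type*} (h : α → ℤ) (w : List α) : ℤ :=
  (w.map h).sum

/-- The generalized Dyck words for `h`: total valuation `0`, and every left factor has
nonnegative valuation. -/
def dyckLanguage {α : Type*} (h : α → ℤ) : Language α :=
  {w | valuation h w = 0 ∧ ∀ w₁ : List α, w₁ <+: w → 0 ≤ valuation h w₁}

/-- `w'` is a proper factor of `w`: `w = w₁ w' w₂` with `w₁`, `w₂` not both empty. -/
def IsProperFactor {α : Type*} (w' w : List α) : Prop :=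
  ∃ w₁ w₂ : List α, w = w₁ ++ w' ++ w₂ ∧ ¬(w₁ = [] ∧ w₂ = [])

/-- `w` has no proper factor that is a Dyck word. The empty word, which is a Dyck word and a
factor of every word, is not counted as such a factor. -/
def IsFactorFree {α : Type*} (h : α → ℤ) (w : List α) : Prop :=
  ∀ w' : List α, w' ≠ [] → IsProperFactor w' w → w' ∉ dyckLanguage h

/-- The language of factor-free Dyck words for `h` (it contains the empty word). -/
def factorFreeDyck {α : Type*} (h : α → ℤ) : Language α :=
  {w | w ∈ dyckLanguage h ∧ IsFactorFree h w}

/-- The valuation of slope `(2m+1)/2`: `h(a) = 2m+1` and `h(b) = -2`. -/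
def slopeVal (m : ℕ) : Letter → ℤ
  | Letter.a => 2 * (m : ℤ) + 1
  | Letter.b => -2

/-- The number of words of length `N` in the language `L` over `{a, b}`
(there are only finitely many words of a given length). -/
noncomputable def numWords (L : Language Letter) (N : ℕ) : ℕ :=
  Set.ncard {w : List Letter | w ∈ L ∧ w.length = N}

/-- The generating function `∑_{w ∈ L} τ ^ |w|` of a language over `{a, b}`. -/
noncomputable def lengthGF (L : Language Letter) : PowerSeries ℚ :=
  PowerSeries.mk fun N => (numWords L N : ℚ)

/-- `θ_n`: the number of factor-free Dyck words of slope `(2m+1)/2` and length `(2m+3)n`. -/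
noncomputable def theta (m n : ℕ) : ℕ :=
  numWords (factorFreeDyck (slopeVal m)) ((2 * m + 3) * n)

/-- The partial Bell polynomial `B_{n,k}(z_1, z_2, …)`: the sum of
`n! / (j_1! j_2! ⋯) * (z_1/1!)^{j_1} (z_2/2!)^{j_2} ⋯` over all `j_1, j_2, … ≥ 0` with
`j_1 + j_2 + ⋯ = k` and `j_1 + 2 j_2 + ⋯ = n`. Indices `i > n` are left out, since the second
constraint forces `j_i = 0` for them. The value `z 0` is not used. -/
noncomputable def partialBell (n k : ℕ) (z : ℕ → ℚ) : ℚ :=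
  ∑ j ∈ (Finset.piAntidiag (Finset.Icc 1 n) k).filter
      (fun j => ∑ i ∈ Finset.Icc 1 n, i * j i = n),
    (n.factorial : ℚ) / (∏ i ∈ Finset.Icc 1 n, ((j i).factorial : ℚ)) *
      ∏ i ∈ Finset.Icc 1 n, (z i / (i.factorial : ℚ)) ^ j i

/-- `μ_j`, the binomial coefficient of `m + j` over `m - j`, which is `0` for `j > m`. -/
def mu (m j : ℕ) : ℕ :=
  if j ≤ m then (m + j).choose (m - j) else 0

/-- `Δ_{ν,ℓ}` (for the given `m`). -/
noncomputable def Delta (m ν l : ℕ) : ℚ :=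
  (2 * (l : ℚ) + 1) / (2 * (ν : ℚ) + 2 * (l : ℚ) + 1) *
    ∑ k ∈ Finset.range (ν + 1),
      ((2 * ν + 2 * l + 1).choose k : ℚ) * ((k.factorial : ℚ) / (ν.factorial : ℚ)) *
        partialBell ν k (fun j => (j.factorial : ℚ) * (mu m j : ℚ))

end FactorFreeDyck

/-!
Deleting the first letter `a` of a nonempty factor-free Dyck word leaves a word that descends from
height `h(a) = 2m + 1` to height `0` without containing a Dyck factor. Let `F_d` be the generating
function, by the number of letters `a`, of such descents from height `d`. A descent that starts with
`b` goes on from height `d - 2`. In one that starts with `a`, consider the first return to height at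
most `d`: it ends with `b`, and it cannot hit `d` itself, since that would close a Dyck factor, so
it lands on `d - 1`. Thus `F_d = F_{d-2} + X F_{2m} F_{d-1}` and `F_1 = X F_{2m}`, that is,
`F_d = F_{d-2} + F_1 F_{d-1}`, so that each `F_d` is an explicit polynomial in `F_1`. The case
`d = 2m` becomes the functional equation `F_1 = X (1 + ∑_j μ_j F_1 ^ (2j))`. Lagrange inversion then
gives the coefficients of the powers of `F_1`, which are the numbers `Δ_{ν,ℓ}`, and `F_{2m+1}`
gives the formula for `θ_n`.
-/

namespace FactorFreeDyck

section Series

open PowerSeries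

section CommSemiring

variable {R : Type*} [CommSemiring R]

theorem coeff_X_mul_derivative (f : R⟦X⟧) (n : ℕ) : coeff n (X * d⁄dX R f) = n * coeff n f := by
  cases n with
  | zero => simp
  | succ n => rw [coeff_succ_X_mul, coeff_derivative, mul_comm, Nat.cast_succ]

theorem coeff_pow_eq_zero_of_lt {A : R⟦X⟧} (hA : X ∣ A) {n k : ℕ} (h : n < k) :
    coeff n (A ^ k) = 0 :=
  X_pow_dvd_iff.1 (pow_dvd_pow_of_dvd hA k) n h

theorem coeff_one_add_pow {f : R⟦X⟧} (hf : X ∣ f) (ν N : ℕ) :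
    coeff ν ((1 + f) ^ N) = ∑ k ∈ Finset.range (ν + 1), N.choose k * coeff ν (f ^ k) := by
  have hterm : ∀ k, coeff ν (f ^ k * 1 ^ (N - k) * (N.choose k : R⟦X⟧)) =
      N.choose k * coeff ν (f ^ k) := fun k => by
    rw [one_pow, mul_one, mul_comm, ← nsmul_eq_mul, map_nsmul, nsmul_eq_mul]
  rw [add_comm, add_pow, map_sum, Finset.sum_congr rfl fun k _ => hterm k]
  rcases le_total (N + 1) (ν + 1) with h | h
  · refine Finset.sum_subset (Finset.range_mono h) fun k _ hk => ?_
    rw [Finset.mem_range, not_lt] at hk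
    rw [Nat.choose_eq_zero_of_lt hk, Nat.cast_zero, zero_mul]
  · refine (Finset.sum_subset (Finset.range_mono h) fun k _ hk => ?_).symm
    rw [Finset.mem_range, not_lt] at hk
    rw [coeff_pow_eq_zero_of_lt hf hk, mul_zero]

theorem coeff_sum_monomial_pow (c : ℕ → R) (s : Finset ℕ) (ν k : ℕ) :
    coeff ν ((∑ i ∈ s, monomial i (c i)) ^ k) =
      ∑ j ∈ s.piAntidiag k with ∑ i ∈ s, i * j i = ν,
        (Nat.multinomial s j : R) * ∏ i ∈ s, c i ^ j i := by
  have hprod (j : ℕ → ℕ) : ∏ i ∈ s, monomial i (c i) ^ j i =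
      monomial (∑ i ∈ s, i * j i) (∏ i ∈ s, c i ^ j i) := by
    simp only [monomial_pow, prod_monomial, mul_comm]
  rw [Finset.sum_pow_eq_sum_piAntidiag, map_sum, Finset.sum_filter]
  refine Finset.sum_congr rfl fun j _ => ?_
  rw [hprod, ← nsmul_eq_mul, map_nsmul, coeff_monomial, nsmul_eq_mul, mul_ite, mul_zero]
  simp only [eq_comm]

theorem coeff_pow_eq_coeff_sum_monomial_pow {f : R⟦X⟧} (hf : X ∣ f) (ν k : ℕ) :
    coeff ν (f ^ k) = coeff ν ((∑ i ∈ Finset.Icc 1 ν, monomial i (coeff i f)) ^ k) := by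
  have htrunc : trunc (ν + 1) f =
      trunc (ν + 1) (∑ i ∈ Finset.Icc 1 ν, monomial i (coeff i f) : R⟦X⟧) := by
    ext i
    rw [coeff_trunc, coeff_trunc, map_sum]
    simp only [coeff_monomial, Finset.sum_ite_eq, Finset.mem_Icc]
    rcases i.eq_zero_or_pos with rfl | hi
    · simp [X_dvd_iff.1 hf]
    · split_ifs <;> first | rfl | omega
  rw [← coeff_coe_trunc_of_lt (Nat.lt_succ_self ν), ← trunc_trunc_pow, htrunc, trunc_trunc_pow,
    coeff_coe_trunc_of_lt (Nat.lt_succ_self ν)]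

end CommSemiring

section CommRing

variable {R : Type*} [CommRing R]

theorem X_mul_derivative_X_pow (k : ℕ) : X * d⁄dX R (X ^ k) = (k : R⟦X⟧) * X ^ k := by
  cases k with
  | zero => simp
  | succ k =>
    rw [derivative_pow, derivative_X, Nat.add_sub_cancel]
    ring

theorem natCast_mul_X_mul_derivative_mul_pow (P : R⟦X⟧) (k n : ℕ) :
    ((n + 1 : ℕ) : R⟦X⟧) * (X * d⁄dX R (X ^ k * P) * P ^ n) =
      X * d⁄dX R (X ^ k * P ^ (n + 1)) + ((k * n : ℕ) : R⟦X⟧) * (X ^ k * P ^ (n + 1)) := by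
  rw [Derivation.leibniz _ (X ^ k) P, Derivation.leibniz _ (X ^ k) (P ^ (n + 1)),
    derivative_pow P, Nat.add_sub_cancel]
  simp only [smul_eq_mul]
  push_cast
  linear_combination P ^ (n + 1) * n * X_mul_derivative_X_pow (R := R) k

theorem coeff_subst_eq_sum_range {A : R⟦X⟧} (hA : X ∣ A) (f : R⟦X⟧) (n : ℕ) :
    coeff n (f.subst A) = ∑ d ∈ Finset.range (n + 1), coeff d f * coeff n (A ^ d) := by
  rw [coeff_subst' (.of_constantCoeff_zero' (X_dvd_iff.1 hA))]
  refine finsum_eq_sum_of_support_subset _ fun d hd => ?_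
  by_contra h
  refine hd ?_
  simp only [Finset.coe_range, Set.mem_Iio, not_lt] at h
  simp only [coeff_pow_eq_zero_of_lt hA h, smul_zero]

theorem natCast_mul_coeff_subst {A P : R⟦X⟧} (hA : X ∣ A) {n : ℕ}
    (hpow : ∀ k : ℕ, n * coeff n (A ^ k) = k * coeff n (X ^ k * P ^ n)) (f : R⟦X⟧) :
    n * coeff n (f.subst A) = coeff n (X * d⁄dX R f * P ^ n) := by
  have hcoeff : ∀ d ∈ Finset.range (n + 1),
      coeff n (X ^ d * P ^ n) = coeff (n - d) (P ^ n) := fun d hd => by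
    rw [coeff_X_pow_mul', if_pos (Finset.mem_range_succ_iff.1 hd)]
  rw [coeff_subst_eq_sum_range hA, Finset.mul_sum, coeff_mul,
    Finset.Nat.sum_antidiagonal_eq_sum_range_succ_mk]
  refine Finset.sum_congr rfl fun d hd => ?_
  rw [coeff_X_mul_derivative, mul_left_comm, hpow, hcoeff d hd]
  ring

/-- The **Lagrange inversion formula**; the factor `X ^ k` shifts the coefficient of `P ^ n` to
the index `n - k` without a truncated subtraction. -/
theorem natCast_mul_coeff_pow_of_eq_X_mul_subst [IsAddTorsionFree R] {A P : R⟦X⟧}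
    (hA : A = X * P.subst A) (n : ℕ) :
    ∀ k : ℕ, n * coeff n (A ^ k) = k * coeff n (X ^ k * P ^ n) := by
  have hX : X ∣ A := ⟨_, hA⟩
  have hs : HasSubst A := .of_constantCoeff_zero' (X_dvd_iff.1 hX)
  induction n with
  | zero => rintro (_ | k) <;> simp
  | succ n ih =>
    rintro (_ | k)
    · simp [coeff_one]
    have hstep : coeff (n + 1) (A ^ (k + 1)) = coeff n ((X ^ k * P).subst A) := by
      rw [pow_succ]
      nth_rw 2 [hA]
      rw [mul_left_comm, coeff_succ_X_mul, subst_mul hs, subst_pow hs, subst_X hs]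
    rw [hstep, pow_succ' X, mul_assoc X, coeff_succ_X_mul]
    rcases eq_or_ne n 0 with rfl | hn
    · cases k <;> simp [coeff_subst_eq_sum_range hX]
    have hcoeff := congrArg (coeff n) (natCast_mul_X_mul_derivative_mul_pow P k n)
    simp only [← nsmul_eq_mul, map_add, map_nsmul, coeff_X_mul_derivative,
      ← natCast_mul_coeff_subst hX ih] at hcoeff
    refine nsmul_right_injective hn ?_
    simp only [nsmul_eq_mul] at hcoeff ⊢
    push_cast at hcoeff ⊢
    linear_combination hcoeff

theorem natCast_mul_coeff_pow_of_eq_X_mul_subst_sq [IsAddTorsionFree R] {A Φ : R⟦X⟧}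
    (hA : A = X * Φ.subst (A ^ 2)) (k ν : ℕ) :
    ((k + 2 * ν : ℕ) : R) * coeff (k + 2 * ν) (A ^ k) = k * coeff ν (Φ ^ (k + 2 * ν)) := by
  have hX : X ∣ A := ⟨_, hA⟩
  have hs : HasSubst A := .of_constantCoeff_zero' (X_dvd_iff.1 hX)
  have hexpand : A = X * (Φ.expand 2 two_ne_zero).subst A := by
    rwa [expand_apply, subst_comp_subst_apply (.X_pow two_ne_zero) hs, subst_pow hs, subst_X hs]
  rw [natCast_mul_coeff_pow_of_eq_X_mul_subst hexpand, ← map_pow, coeff_X_pow_mul',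
    if_pos (Nat.le_add_right _ _), Nat.add_sub_cancel_left, coeff_expand_mul]

end CommRing

end Series

section Bell

open PowerSeries

theorem factorial_div_mul_partialBell {f : ℚ⟦X⟧} (hf : X ∣ f) {z : ℕ → ℚ}
    (hz : ∀ i ≠ 0, z i = i.factorial * coeff i f) (ν k : ℕ) :
    (k.factorial : ℚ) / ν.factorial * partialBell ν k z = coeff ν (f ^ k) := by
  rw [coeff_pow_eq_coeff_sum_monomial_pow hf, coeff_sum_monomial_pow, partialBell, Finset.mul_sum]
  refine Finset.sum_congr rfl fun j hj => ?_
  have hk : ∑ i ∈ Finset.Icc 1 ν, j i = k :=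
    (Finset.mem_piAntidiag.1 (Finset.mem_filter.1 hj).1).1
  have hmultinomial : (∏ i ∈ Finset.Icc 1 ν, ((j i).factorial : ℚ)) *
      Nat.multinomial (Finset.Icc 1 ν) j = k.factorial := by
    rw [← hk]
    exact_mod_cast Nat.multinomial_spec (Finset.Icc 1 ν) j
  have hpow : ∏ i ∈ Finset.Icc 1 ν, (z i / i.factorial) ^ j i =
      ∏ i ∈ Finset.Icc 1 ν, coeff i f ^ j i :=
    Finset.prod_congr rfl fun i hi => by
      rw [hz i (Nat.one_le_iff_ne_zero.1 (Finset.mem_Icc.1 hi).1),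
        mul_div_cancel_left₀ _ (by positivity)]
  have hne : ∏ i ∈ Finset.Icc 1 ν, ((j i).factorial : ℚ) ≠ 0 :=
    Finset.prod_ne_zero_iff.2 fun i _ => by positivity
  rw [hpow, ← hmultinomial]
  field_simp

/-- The generating function `1 + ∑_{1 ≤ j ≤ m} μ_j X ^ j` of the binomial coefficients `μ_j`. -/
noncomputable def muSeries (m : ℕ) : ℚ⟦X⟧ := mk fun j => (mu m j : ℚ)

theorem X_dvd_muSeries_sub_one (m : ℕ) : X ∣ muSeries m - 1 := by
  rw [X_dvd_iff, map_sub, ← coeff_zero_eq_constantCoeff_apply]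
  simp [muSeries, mu]

theorem mu_eq_choose (m j : ℕ) : mu m j = (m + j).choose (2 * j) := by
  rw [mu]
  split_ifs with h
  · exact Nat.choose_symm_of_eq_add (by omega)
  · exact (Nat.choose_eq_zero_of_lt (by omega)).symm

theorem subst_muSeries (m : ℕ) {B : ℚ⟦X⟧} (hB : HasSubst B) :
    (muSeries m).subst B = ∑ j ∈ Finset.range (m + 1), (m + j).choose (2 * j) * B ^ j := by
  have hpoly : muSeries m =
      ((∑ j ∈ Finset.range (m + 1), Polynomial.monomial j (mu m j : ℚ) : Polynomial ℚ) : ℚ⟦X⟧) := by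
    ext j
    simp +contextual [muSeries, Polynomial.coeff_monomial, mu]
  rw [hpoly, subst_coe hB, map_sum]
  simp [Polynomial.aeval_monomial, mu_eq_choose]

theorem Delta_eq_coeff_muSeries_pow (m ν l : ℕ) :
    Delta m ν l = (2 * (l : ℚ) + 1) / (2 * (ν : ℚ) + 2 * (l : ℚ) + 1) *
      coeff ν (muSeries m ^ (2 * ν + 2 * l + 1)) := by
  have hcoeff : ∀ i ≠ 0, (i.factorial : ℚ) * mu m i = i.factorial * coeff i (muSeries m - 1) :=
    fun i hi => by simp [muSeries, coeff_one, hi]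
  rw [← add_sub_cancel 1 (muSeries m), coeff_one_add_pow (X_dvd_muSeries_sub_one m), Delta]
  simp only [mul_assoc, factorial_div_mul_partialBell (X_dvd_muSeries_sub_one m) hcoeff]

end Bell

section Recurrence

open Finset

variable {R : Type*} [CommSemiring R] (A : R)

theorem sum_choose_two_mul_succ (r : ℕ) :
    ∑ j ∈ range (r + 2), (r + 1 + j).choose (2 * j) * A ^ (2 * j) =
      ∑ j ∈ range (r + 1), (r + j).choose (2 * j) * A ^ (2 * j) +
        A * ∑ l ∈ range (r + 1), (r + l + 1).choose (2 * l + 1) * A ^ (2 * l + 1) := by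
  have hextend : ∑ j ∈ range (r + 1), ((r + j).choose (2 * j) : R) * A ^ (2 * j) =
      1 + ∑ j ∈ range (r + 1), (r + j + 1).choose (2 * (j + 1)) * A ^ (2 * (j + 1)) := by
    rw [sum_range_succ', sum_range_succ (n := r),
      Nat.choose_eq_zero_of_lt (n := r + r + 1) (by omega)]
    simp [add_comm, add_assoc]
  rw [sum_range_succ', hextend, mul_sum, add_assoc (1 : R), ← sum_add_distrib, add_comm]
  refine congrArg₂ _ (by simp) (sum_congr rfl fun j _ => ?_)
  rw [show r + 1 + (j + 1) = (r + j + 1) + 1 by ring, show 2 * (j + 1) = (2 * j + 1) + 1 by ring,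
    Nat.choose_succ_succ' (r + j + 1) (2 * j + 1)]
  push_cast
  ring

theorem sum_choose_two_mul_add_one_succ (r : ℕ) :
    ∑ l ∈ range (r + 2), (r + 1 + l + 1).choose (2 * l + 1) * A ^ (2 * l + 1) =
      ∑ l ∈ range (r + 1), (r + l + 1).choose (2 * l + 1) * A ^ (2 * l + 1) +
        A * ∑ j ∈ range (r + 2), (r + 1 + j).choose (2 * j) * A ^ (2 * j) := by
  have hextend : ∑ l ∈ range (r + 1), ((r + l + 1).choose (2 * l + 1) : R) * A ^ (2 * l + 1) =
      ∑ l ∈ range (r + 2), (r + l + 1).choose (2 * l + 1) * A ^ (2 * l + 1) := by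
    rw [sum_range_succ _ (r + 1), Nat.choose_eq_zero_of_lt (n := r + (r + 1) + 1) (by omega)]
    simp only [Nat.cast_zero, zero_mul, add_zero]
  rw [hextend, mul_sum, ← sum_add_distrib]
  refine sum_congr rfl fun l _ => ?_
  rw [Nat.choose_succ_succ' (r + 1 + l) (2 * l), add_right_comm r 1 l]
  push_cast
  ring

variable {A}

theorem eq_sum_choose_of_recurrence {C : ℕ → R} (h0 : C 0 = 1) (h1 : C 1 = A)
    (h : ∀ d, C (d + 2) = C d + A * C (d + 1)) (r : ℕ) :
    C (2 * r) = ∑ j ∈ range (r + 1), (r + j).choose (2 * j) * A ^ (2 * j) ∧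
      C (2 * r + 1) =
        ∑ l ∈ range (r + 1), (r + l + 1).choose (2 * l + 1) * A ^ (2 * l + 1) := by
  induction r with
  | zero => simp [h0, h1]
  | succ r ih =>
    have heven : C (2 * (r + 1)) =
        ∑ j ∈ range (r + 2), (r + 1 + j).choose (2 * j) * A ^ (2 * j) := by
      rw [sum_choose_two_mul_succ, ← ih.1, ← ih.2, ← h, mul_add_one]
    refine ⟨heven, ?_⟩
    rw [sum_choose_two_mul_add_one_succ, ← ih.2, ← heven]
    exact h (2 * r + 1)

end Recurrence

section Words

variable {α : Type*} {h : α → ℤ} {u v w : List α} {x : α} {d d₁ d₂ : ℤ}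

@[simp]
theorem valuation_nil (h : α → ℤ) : valuation h [] = 0 := rfl

@[simp]
theorem valuation_cons (h : α → ℤ) (x : α) (w : List α) :
    valuation h (x :: w) = h x + valuation h w := by
  simp [valuation]

@[simp]
theorem valuation_append (h : α → ℤ) (u v : List α) :
    valuation h (u ++ v) = valuation h u + valuation h v := by
  simp [valuation]

theorem mem_dyckLanguage_iff_forall_suffix :
    w ∈ dyckLanguage h ↔ valuation h w = 0 ∧ ∀ s, s <:+ w → valuation h s ≤ 0 := by
  refine and_congr_right fun hw => ⟨?_, ?_⟩
  · rintro hprefix s ⟨p, rfl⟩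
    have := hprefix p (List.prefix_append p s)
    rw [valuation_append] at hw
    linarith
  · rintro hsuffix p ⟨s, rfl⟩
    have := hsuffix s (List.suffix_append p s)
    rw [valuation_append] at hw
    linarith

/-- A word is Dyck-free if none of its nonempty factors, itself included, is a Dyck word. -/
def DyckFree (h : α → ℤ) (w : List α) : Prop :=
  ∀ v, v <:+: w → v ≠ [] → v ∉ dyckLanguage h

theorem DyckFree.of_infix (hw : DyckFree h w) (hvw : v <:+: w) : DyckFree h v :=
  fun s hs => hw s (hs.trans hvw)

/-- The Dyck-free words that descend from height `d` to height `0` and stay nonnegative on the way.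
The height reached after the prefix `p` of `w = p ++ s` is `d + h(p) = -h(s)`, whence the condition
on suffixes. -/
def descent (h : α → ℤ) (d : ℤ) : Language α :=
  {w | valuation h w = -d ∧ (∀ s, s <:+ w → valuation h s ≤ 0) ∧ DyckFree h w}

theorem valuation_suffix_neg (hw : w ∈ descent h d) (hv : v <:+ w) (hne : v ≠ []) :
    valuation h v < 0 := by
  obtain ⟨-, hsuffix, hfree⟩ := hw
  refine lt_of_le_of_ne (hsuffix v hv) fun hzero => hfree v hv.isInfix hne ?_
  exact mem_dyckLanguage_iff_forall_suffix.2 ⟨hzero, fun s hs => hsuffix s (hs.trans hv)⟩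

theorem eq_nil_of_mem_descent (hw : w ∈ descent h d) (hd : d ≤ 0) : w = [] := by
  by_contra hne
  have := valuation_suffix_neg hw List.suffix_rfl hne
  linarith [hw.1]

theorem nil_mem_descent_iff : [] ∈ descent h d ↔ d = 0 := by
  refine ⟨fun hnil => by simpa [eq_comm] using hnil.1, ?_⟩
  rintro rfl
  refine ⟨rfl, fun s hs => ?_, fun v hv hne => absurd (List.infix_nil.1 hv) hne⟩
  rw [List.suffix_nil.1 hs, valuation_nil]

theorem descent_zero (h : α → ℤ) : descent h 0 = 1 := by
  ext w
  rw [Language.mem_one]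
  refine ⟨fun hw => eq_nil_of_mem_descent hw le_rfl, ?_⟩
  rintro rfl
  exact nil_mem_descent_iff.2 rfl

theorem descent_of_neg (hd : d < 0) : descent h d = 0 := by
  ext w
  refine iff_of_false (fun hw => hd.ne ?_) (Language.notMem_zero w)
  rw [eq_nil_of_mem_descent hw hd.le] at hw
  exact nil_mem_descent_iff.1 hw

theorem isAntichain_prefix_descent (h : α → ℤ) (d : ℤ) :
    IsAntichain (· <+: ·) (descent h d : Set (List α)) := by
  rintro u hu _ hv hne ⟨s, rfl⟩
  have hs : s ≠ [] := by
    rintro rfl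
    exact hne (List.append_nil u).symm
  have hneg := valuation_suffix_neg hv (List.suffix_append u s) hs
  have hsum := hv.1
  rw [valuation_append, hu.1] at hsum
  linarith

theorem append_mem_descent_iff (hu : u ∈ descent h d₁) :
    u ++ v ∈ descent h (d₁ + d₂) ↔ v ∈ descent h d₂ := by
  constructor
  · rintro ⟨hval, hsuffix, hfree⟩
    refine ⟨?_, fun s hs => hsuffix s (hs.trans (List.suffix_append u v)),
      hfree.of_infix (List.suffix_append u v).isInfix⟩
    rw [valuation_append, hu.1] at hval
    linarith
  · rintro ⟨hval, hsuffix, hfree⟩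
    refine ⟨by rw [valuation_append, hu.1, hval]; ring, ?_, fun f hf hne hdyck => ?_⟩
    · rintro s ⟨r, hr⟩
      rcases List.append_eq_append_iff.1 hr with ⟨t, ht, rfl⟩ | ⟨t, -, ht⟩
      · have := hu.2.1 t ⟨r, ht.symm⟩
        have := hsuffix v List.suffix_rfl
        rw [valuation_append]
        linarith
      · exact hsuffix s ⟨t, ht.symm⟩
    · rcases List.infix_append_iff_ne_nil.1 hf with hfu | hfv | ⟨s, t, hs, -, rfl, hsu, -⟩
      · exact hu.2.2 f hfu hne hdyck
      · exact hfree f hfv hne hdyck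
      · exact (valuation_suffix_neg hu hsu hs).not_ge (hdyck.2 s (List.prefix_append s t))

theorem cons_mem_descent_iff (hd : 0 < d) :
    x :: w ∈ descent h d ↔
      w ∈ descent h (d + h x) ∧ ∀ t, t <+: w → x :: t ∉ dyckLanguage h := by
  constructor
  · rintro ⟨hval, hsuffix, hfree⟩
    have hw : w <:+ x :: w := List.suffix_cons x w
    refine ⟨⟨?_, fun s hs => hsuffix s (hs.trans hw), hfree.of_infix hw.isInfix⟩, fun t ht =>
      hfree _ ((List.prefix_cons_inj x).2 ht).isInfix (List.cons_ne_nil x t)⟩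
    rw [valuation_cons] at hval
    linarith
  · rintro ⟨⟨hval, hsuffix, hfree⟩, hdyck⟩
    have hval' : valuation h (x :: w) = -d := by rw [valuation_cons, hval]; ring
    refine ⟨hval', fun s hs => ?_, fun v hv hne => ?_⟩
    · rcases List.suffix_cons_iff.1 hs with rfl | hs
      · linarith
      · exact hsuffix s hs
    · rcases List.infix_cons_iff.1 hv with hv | hv
      · rcases List.prefix_cons_iff.1 hv with rfl | ⟨t, rfl, ht⟩
        · exact absurd rfl hne
        · exact hdyck t ht
      · exact hfree v hv hne

theorem cons_mem_descent_iff_of_neg (hx : h x < 0) (hd : 0 < d) :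
    x :: w ∈ descent h d ↔ w ∈ descent h (d + h x) := by
  rw [cons_mem_descent_iff hd, and_iff_left]
  intro t _ hdyck
  have := hdyck.2 [x] ⟨t, rfl⟩
  simp only [valuation_cons, valuation_nil, add_zero] at this
  omega

theorem nil_mem_factorFreeDyck (h : α → ℤ) : [] ∈ factorFreeDyck h := by
  refine ⟨mem_dyckLanguage_iff_forall_suffix.2 ⟨rfl, fun s hs => ?_⟩, fun v hne => ?_⟩
  · rw [List.suffix_nil.1 hs, valuation_nil]
  · rintro ⟨p, s, hps, -⟩
    simp_all

theorem cons_mem_factorFreeDyck_iff :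
    x :: w ∈ factorFreeDyck h ↔ w ∈ descent h (h x) := by
  constructor
  · rintro ⟨hdyck, hfree⟩
    obtain ⟨hval, hsuffix⟩ := mem_dyckLanguage_iff_forall_suffix.1 hdyck
    rw [valuation_cons] at hval
    refine ⟨by linarith, fun s hs => hsuffix s (hs.trans (List.suffix_cons x w)), ?_⟩
    rintro v ⟨p, s, rfl⟩ hne
    exact hfree v hne ⟨x :: p, s, rfl, fun hnil => List.cons_ne_nil x p hnil.1⟩
  · intro hw
    have hval : valuation h (x :: w) = 0 := by rw [valuation_cons, hw.1]; ring
    refine ⟨mem_dyckLanguage_iff_forall_suffix.2 ⟨hval, fun s hs => ?_⟩, ?_⟩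
    · rcases List.suffix_cons_iff.1 hs with rfl | hs
      · exact hval.le
      · exact hw.2.1 s hs
    · rintro v hne ⟨_ | ⟨y, p⟩, s, hvs, hproper⟩ hdyck
      · rw [List.nil_append] at hvs
        obtain ⟨t, rfl, ht⟩ : ∃ t, v = x :: t ∧ t ++ s = w := by
          cases v <;> simp_all
        have hneg := valuation_suffix_neg hw ⟨t, ht⟩ fun hs => hproper ⟨rfl, hs⟩
        rw [hvs, valuation_append, hdyck.1] at hval
        linarith
      · obtain ⟨-, rfl⟩ := List.cons.inj hvs
        exact hw.2.2 v (List.infix_append p v s) hne hdyck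

theorem mem_singleton_mul {L : Language α} : w ∈ {[x]} * L ↔ ∃ v ∈ L, x :: v = w := by
  rw [Language.mem_mul]
  constructor
  · rintro ⟨_, rfl, v, hv, rfl⟩
    exact ⟨v, hv, rfl⟩
  · rintro ⟨v, hv, rfl⟩
    exact ⟨[x], rfl, v, hv, rfl⟩

theorem eq_and_eq_of_append_eq_append_of_isAntichain {L : Language α}
    (hL : IsAntichain (· <+: ·) (L : Set (List α)))
    {u' v' : List α} (hu : u ∈ L) (hu' : u' ∈ L) (huv : u ++ v = u' ++ v') :
    u = u' ∧ v = v' := by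
  have huu' : u = u' := by
    rcases List.prefix_or_prefix_of_prefix (l₁ := u) (l₂ := u') ⟨v, huv⟩ ⟨v', rfl⟩ with hpre | hpre
    · exact hL.eq hu hu' hpre
    · exact (hL.eq hu' hu hpre).symm
  subst huu'
  exact ⟨rfl, List.append_cancel_left huv⟩

theorem exists_minimal_prefix {P : List α → Prop} (hnil : ¬P []) (hw : P w) :
    ∃ p y r, w = p ++ y :: r ∧ P (p ++ [y]) ∧ ∀ v, v <+: p → ¬P v := by
  induction w generalizing P with
  | nil => exact absurd hw hnil
  | cons x w ih =>
    by_cases hx : P [x]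
    · refine ⟨[], x, w, rfl, hx, fun v hv => ?_⟩
      rwa [List.prefix_nil.1 hv]
    · obtain ⟨p, y, r, rfl, hy, hmin⟩ := ih (P := fun v => P (x :: v)) hx hw
      refine ⟨x :: p, y, r, rfl, hy, fun v hv => ?_⟩
      rcases List.prefix_cons_iff.1 hv with rfl | ⟨t, rfl, ht⟩
      · exact hnil
      · exact hmin t ht

end Words

section TwoLetters

open Letter

variable {h : Letter → ℤ} {d : ℤ} {w : List Letter}

theorem factorFreeDyck_eq_one_add (hb : h b < 0) :
    factorFreeDyck h = 1 + {[a]} * descent h (h a) := by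
  ext w
  rw [Language.mem_add, Language.mem_one, mem_singleton_mul]
  rcases w with _ | ⟨_ | _, w⟩
  · simp [nil_mem_factorFreeDyck]
  · simp [cons_mem_factorFreeDyck_iff]
  · simp [cons_mem_factorFreeDyck_iff, descent_of_neg hb]

theorem b_cons_mem_descent_iff (hb : h b = -2) (hd : 0 < d) :
    b :: w ∈ descent h d ↔ w ∈ descent h (d - 2) := by
  rw [cons_mem_descent_iff_of_neg (by omega) hd, hb, sub_eq_add_neg]

theorem exists_eq_append_of_a_cons_mem_descent (ha : 0 < h a) (hb : h b = -2) (hd : 0 < d)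
    (hw : a :: w ∈ descent h d) :
    ∃ u ∈ descent h (h a - 1), ∃ r, w = u ++ b :: r := by
  obtain ⟨hdesc, hdyck⟩ := (cons_mem_descent_iff hd).1 hw
  obtain ⟨u, y, r, rfl, hy, hmin⟩ :=
    exists_minimal_prefix (P := fun t => h a + valuation h t ≤ 0) (w := w)
      (by simpa using ha) (by linarith [hdesc.1])
  have hpos : ∀ v, v <+: u → 0 < h a + valuation h v := fun v hv => not_le.1 (hmin v hv)
  have hu := hpos u List.prefix_rfl
  rw [valuation_append, valuation_cons, valuation_nil] at hy
  obtain rfl : y = b := by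
    cases y
    · linarith
    · rfl
  have hne_two : h a + valuation h u ≠ 2 := by
    intro htwo
    refine hdyck (u ++ [b]) (by simp) ⟨?_, fun v hv => ?_⟩
    · simp only [valuation_cons, valuation_append, valuation_nil]
      linarith
    rcases List.prefix_cons_iff.1 hv with rfl | ⟨t, rfl, ht⟩
    · rfl
    rw [valuation_cons]
    rcases List.prefix_concat_iff.1 ht with rfl | ht
    · simp only [valuation_cons, valuation_append, valuation_nil]
      linarith
    · exact (hpos t ht).le
  have hval : valuation h u = -(h a - 1) := by omega
  refine ⟨u, ⟨hval, ?_, hdesc.2.2.of_infix (List.prefix_append u _).isInfix⟩, r, rfl⟩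
  rintro s ⟨p, rfl⟩
  have := hpos p (List.prefix_append p s)
  rw [valuation_append] at hval
  linarith

theorem a_cons_notMem_dyckLanguage {u r t : List Letter} (hb : h b = -2)
    (hu : u ∈ descent h (h a - 1)) (ht : t <+: u ++ b :: r) : a :: t ∉ dyckLanguage h := by
  intro hdyck
  have hub : ¬u ++ [b] <+: t := fun hub => by
    have := hdyck.2 (a :: (u ++ [b])) ((List.prefix_cons_inj a).2 hub)
    simp only [valuation_cons, valuation_append, valuation_nil, hu.1, hb] at this
    omega
  have htu : t <+: u := by
    rcases List.prefix_or_prefix_of_prefix ht (l₂ := u ++ [b]) (by simp) with htub | hubt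
    · exact (List.prefix_concat_iff.1 htub).resolve_left (by rintro rfl; exact hub List.prefix_rfl)
    · exact absurd hubt hub
  obtain ⟨s, rfl⟩ := htu
  have hs := hu.2.1 s (List.suffix_append t s)
  have hval := hu.1
  have hzero := hdyck.1
  rw [valuation_append] at hval
  rw [valuation_cons] at hzero
  linarith

theorem a_cons_mem_descent_iff (ha : 0 < h a) (hb : h b = -2) (hd : 0 < d) :
    a :: w ∈ descent h d ↔
      ∃ u ∈ descent h (h a - 1), ∃ v ∈ descent h (d - 1), u ++ b :: v = w := by
  have happend {u r : List Letter} (hu : u ∈ descent h (h a - 1)) :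
      u ++ b :: r ∈ descent h (d + h a) ↔ r ∈ descent h (d - 1) := by
    rw [show d + h a = h a - 1 + (d + 1) by ring, append_mem_descent_iff hu,
      b_cons_mem_descent_iff hb (by omega), show d + 1 - 2 = d - 1 by ring]
  constructor
  · intro hw
    obtain ⟨u, hu, r, rfl⟩ := exists_eq_append_of_a_cons_mem_descent ha hb hd hw
    exact ⟨u, hu, r, (happend hu).1 ((cons_mem_descent_iff hd).1 hw).1, rfl⟩
  · rintro ⟨u, hu, r, hr, rfl⟩
    exact (cons_mem_descent_iff hd).2
      ⟨(happend hu).2 hr, fun t ht => a_cons_notMem_dyckLanguage hb hu ht⟩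

theorem descent_eq_add (ha : 0 < h a) (hb : h b = -2) (hd : 0 < d) :
    descent h d = {[b]} * descent h (d - 2) +
      {[a]} * (descent h (h a - 1) * ({[b]} * descent h (d - 1))) := by
  ext w
  rw [Language.mem_add, mem_singleton_mul, mem_singleton_mul]
  rcases w with _ | ⟨_ | _, w⟩
  · simp [nil_mem_descent_iff, hd.ne']
  · simp [a_cons_mem_descent_iff ha hb hd, Language.mem_mul (l := descent h _), mem_singleton_mul]
  · simp [b_cons_mem_descent_iff hb hd]

end TwoLetters

section CountGF

open PowerSeries Finset

variable {α : Type*} [DecidableEq α] {x : α} {L M : Language α}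

/-- The words of `L` in which the letter `x` occurs `N` times. -/
def countFiber (x : α) (L : Language α) (N : ℕ) : Set (List α) :=
  {w | w ∈ L ∧ w.count x = N}

/-- The generating function of `L` by the number of occurrences of the letter `x`; its `N`-th
coefficient has the junk value `0` where the corresponding `countFiber` is infinite. -/
noncomputable def countGF (x : α) (L : Language α) : ℚ⟦X⟧ :=
  mk fun N => ((countFiber x L N).ncard : ℚ)

theorem countFiber_add (L M : Language α) (N : ℕ) :
    countFiber x (L + M) N = countFiber x L N ∪ countFiber x M N := by
  ext w
  simp only [countFiber, Language.mem_add, Set.mem_union, Set.mem_ofPred_eq, or_and_right]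

theorem countFiber_mul (L M : Language α) (N : ℕ) :
    countFiber x (L * M) N =
      ⋃ p ∈ antidiagonal N, Set.image2 (· ++ ·) (countFiber x L p.1) (countFiber x M p.2) := by
  ext w
  simp only [Set.mem_iUnion, Set.mem_image2, exists_prop, HasAntidiagonal.mem_antidiagonal,
    Prod.exists]
  constructor
  · rintro ⟨⟨u, hu, v, hv, rfl⟩, hN⟩
    exact ⟨u.count x, v.count x, by rwa [List.count_append] at hN, u, ⟨hu, rfl⟩, v, ⟨hv, rfl⟩, rfl⟩
  · rintro ⟨_, _, hN, u, ⟨hu, rfl⟩, v, ⟨hv, rfl⟩, rfl⟩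
    exact ⟨⟨u, hu, v, hv, rfl⟩, by rwa [List.count_append]⟩

theorem finite_countFiber_singleton (u : List α) (N : ℕ) : (countFiber x {u} N).Finite :=
  (Set.finite_singleton u).subset fun _ hw => hw.1

theorem finite_countFiber_mul (hL : ∀ N, (countFiber x L N).Finite)
    (hM : ∀ N, (countFiber x M N).Finite) (N : ℕ) : (countFiber x (L * M) N).Finite := by
  rw [countFiber_mul]
  exact (antidiagonal N).finite_toSet.biUnion fun p _ => (hL p.1).image2 _ (hM p.2)

theorem countGF_zero (x : α) : countGF x 0 = 0 := by
  ext N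
  have hfiber : countFiber x 0 N = ∅ := by
    ext w
    simp [countFiber]
  rw [countGF, coeff_mk, hfiber, Set.ncard_empty, Nat.cast_zero, map_zero]

theorem countGF_singleton (x : α) (u : List α) : countGF x {u} = X ^ u.count x := by
  ext N
  have hfiber : countFiber x {u} N = if N = u.count x then {u} else ∅ := by
    ext w
    change w = u ∧ w.count x = N ↔ _
    split_ifs <;> grind
  rw [countGF, coeff_mk, hfiber, coeff_X_pow]
  split_ifs <;> simp

theorem countGF_one (x : α) : countGF x 1 = 1 := countGF_singleton x []

theorem countGF_add (hL : ∀ N, (countFiber x L N).Finite) (hM : ∀ N, (countFiber x M N).Finite)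
    (hdisj : ∀ w ∈ L, w ∉ M) : countGF x (L + M) = countGF x L + countGF x M := by
  ext N
  have hdisj' : Disjoint (countFiber x L N) (countFiber x M N) :=
    Set.disjoint_left.2 fun w hw hw' => hdisj w hw.1 hw'.1
  simp only [countGF, coeff_mk, map_add]
  rw [countFiber_add, Set.ncard_union_eq hdisj' (hL N) (hM N), Nat.cast_add]

/-- For a prefix code `L` the factorization of a word of `L * M` is unique. -/
theorem countGF_mul (hL : ∀ N, (countFiber x L N).Finite) (hM : ∀ N, (countFiber x M N).Finite)
    (hcode : IsAntichain (· <+: ·) (L : Set (List α))) :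
    countGF x (L * M) = countGF x L * countGF x M := by
  ext N
  have hcard (p : ℕ × ℕ) :
      (Set.image2 (· ++ ·) (countFiber x L p.1) (countFiber x M p.2)).ncard =
        (countFiber x L p.1).ncard * (countFiber x M p.2).ncard := by
    rw [← Set.image_prod, Set.InjOn.ncard_image, Set.ncard_prod]
    rintro ⟨u, v⟩ ⟨hu, -⟩ ⟨u', v'⟩ ⟨hu', -⟩ huv
    obtain ⟨rfl, rfl⟩ := eq_and_eq_of_append_eq_append_of_isAntichain hcode hu.1 hu'.1 huv
    rfl
  have hdisj : (antidiagonal N : Set (ℕ × ℕ)).PairwiseDisjoint fun p =>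
      Set.image2 (· ++ ·) (countFiber x L p.1) (countFiber x M p.2) := by
    rintro p - q - hpq
    refine Set.disjoint_left.2 ?_
    rintro _ ⟨u, hu, v, hv, rfl⟩ ⟨u', hu', v', hv', huv⟩
    obtain ⟨rfl, rfl⟩ := eq_and_eq_of_append_eq_append_of_isAntichain hcode hu'.1 hu.1 huv
    exact hpq (Prod.ext (hu.2.symm.trans hu'.2) (hv.2.symm.trans hv'.2))
  have hunion := (antidiagonal N).finite_toSet.ncard_biUnion
    (fun p _ => (hL p.1).image2 (· ++ ·) (hM p.2)) hdisj
  rw [finsum_mem_coe_finset] at hunion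
  simp only [countGF, coeff_mul, coeff_mk]
  rw [countFiber_mul]
  simp only [mem_coe] at hunion
  rw [hunion]
  push_cast [hcard]
  rfl

end CountGF

section DescentGF

open Letter PowerSeries

variable {h : Letter → ℤ} {d : ℤ}

theorem valuation_eq_count_add_length (h : Letter → ℤ) (w : List Letter) :
    valuation h w = (h a - h b) * w.count a + h b * w.length := by
  induction w with
  | nil => simp
  | cons y w ih =>
    rw [valuation_cons, ih, List.length_cons]
    cases y
    · rw [List.count_cons_self]
      push_cast
      ring
    · rw [List.count_cons_of_ne (by simp)]
      push_cast
      ring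

theorem finite_countFiber_descent (hb : h b ≠ 0) (d : ℤ) (N : ℕ) :
    (countFiber a (descent h d) N).Finite := by
  refine (List.finite_length_eq Letter ((-d - (h a - h b) * N) / h b).toNat).subset ?_
  rintro w ⟨hw, rfl⟩
  have hval := hw.1
  rw [valuation_eq_count_add_length] at hval
  rw [Set.mem_ofPred_eq, ← hval, add_sub_cancel_left, Int.mul_ediv_cancel_left _ hb,
    Int.toNat_natCast]

theorem countGF_descent_recurrence (ha : 0 < h a) (hb : h b = -2) (hd : 0 < d) :
    countGF a (descent h d) = countGF a (descent h (d - 2)) +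
      X * countGF a (descent h (h a - 1)) * countGF a (descent h (d - 1)) := by
  have hfin := finite_countFiber_descent (h := h) (by omega)
  have hsingleton := finite_countFiber_singleton (α := Letter) (x := a)
  have hcode (u : List Letter) : IsAntichain (· <+: ·) ({u} : Set (List Letter)) :=
    Set.subsingleton_singleton.isAntichain _
  have hfin_b := finite_countFiber_mul (hsingleton [b]) (hfin (d - 1))
  have hfin_a := finite_countFiber_mul (hfin (h a - 1)) hfin_b
  rw [descent_eq_add ha hb hd, countGF_add, countGF_mul (hsingleton [b]) (hfin _) (hcode _),
    countGF_mul (hsingleton [a]) hfin_a (hcode _),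
    countGF_mul (hfin _) hfin_b (isAntichain_prefix_descent h _),
    countGF_mul (hsingleton [b]) (hfin _) (hcode _), countGF_singleton, countGF_singleton]
  · simp [mul_assoc]
  · exact finite_countFiber_mul (hsingleton [b]) (hfin _)
  · exact finite_countFiber_mul (hsingleton [a]) hfin_a
  · intro w hwb hwa
    rw [mem_singleton_mul] at hwb hwa
    obtain ⟨v, -, rfl⟩ := hwb
    simp at hwa

theorem countGF_descent_one (ha : 0 < h a) (hb : h b = -2) :
    countGF a (descent h 1) = X * countGF a (descent h (h a - 1)) := by
  rw [countGF_descent_recurrence ha hb one_pos, sub_self, descent_zero, countGF_one, mul_one,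
    descent_of_neg (by norm_num), countGF_zero, zero_add]

theorem countGF_descent_eq_sum_choose (ha : 0 < h a) (hb : h b = -2) (r : ℕ) :
    countGF a (descent h (2 * r)) = ∑ j ∈ Finset.range (r + 1),
        (r + j).choose (2 * j) * countGF a (descent h 1) ^ (2 * j) ∧
      countGF a (descent h (2 * r + 1)) = ∑ l ∈ Finset.range (r + 1),
        (r + l + 1).choose (2 * l + 1) * countGF a (descent h 1) ^ (2 * l + 1) := by
  refine mod_cast eq_sum_choose_of_recurrence (C := fun d : ℕ => countGF a (descent h d))
    (by simp [descent_zero, countGF_one]) (by simp) (fun d => ?_) r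
  rw [countGF_descent_one ha hb, countGF_descent_recurrence ha hb (by positivity)]
  push_cast
  rw [add_sub_cancel_right, add_sub_assoc]
  norm_num

theorem countGF_factorFreeDyck (hb : h b < 0) :
    countGF a (factorFreeDyck h) = 1 + X * countGF a (descent h (h a)) := by
  have hfin := finite_countFiber_descent (h := h) hb.ne
  have hsingleton := finite_countFiber_singleton (α := Letter) (x := a)
  have hone : ∀ N, (countFiber a (1 : Language Letter) N).Finite := hsingleton []
  rw [factorFreeDyck_eq_one_add hb,
    countGF_add hone (finite_countFiber_mul (hsingleton _) (hfin _)),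
    countGF_mul (hsingleton _) (hfin _) (Set.subsingleton_singleton.isAntichain _), countGF_one,
    countGF_singleton, List.count_singleton_self, pow_one]
  rintro _ rfl hw
  simp [mem_singleton_mul] at hw

end DescentGF

section Slope

open Letter PowerSeries

variable (m : ℕ)

theorem slopeVal_a_pos : 0 < slopeVal m a := by
  simp only [slopeVal]
  positivity

theorem countGF_descent_one_eq_X_mul_subst :
    countGF a (descent (slopeVal m) 1) =
      X * (muSeries m).subst (countGF a (descent (slopeVal m) 1) ^ 2) := by
  have ha : slopeVal m a - 1 = 2 * m := by simp [slopeVal]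
  have hone := countGF_descent_one (h := slopeVal m) (slopeVal_a_pos m) rfl
  have hX : X ∣ countGF a (descent (slopeVal m) 1) := ⟨_, hone⟩
  have hsubst : HasSubst (countGF a (descent (slopeVal m) 1) ^ 2) :=
    .of_constantCoeff_zero' (X_dvd_iff.1 (dvd_pow hX two_ne_zero))
  rw [subst_muSeries m hsubst]
  simp only [← pow_mul]
  rw [← (countGF_descent_eq_sum_choose (slopeVal_a_pos m) rfl m).1, ← ha, ← hone]

theorem coeff_countGF_descent_one_pow (ν l : ℕ) :
    coeff (2 * l + 1 + 2 * ν) (countGF a (descent (slopeVal m) 1) ^ (2 * l + 1)) =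
      Delta m ν l := by
  have hlagrange := natCast_mul_coeff_pow_of_eq_X_mul_subst_sq
    (countGF_descent_one_eq_X_mul_subst m) (2 * l + 1) ν
  have hne : 2 * (ν : ℚ) + 2 * l + 1 ≠ 0 := by positivity
  rw [Delta_eq_coeff_muSeries_pow, div_mul_eq_mul_div, eq_div_iff hne,
    show 2 * ν + 2 * l + 1 = 2 * l + 1 + 2 * ν by ring]
  push_cast at hlagrange
  linear_combination hlagrange

theorem two_mul_length_of_mem_dyckLanguage {w : List Letter}
    (hw : w ∈ dyckLanguage (slopeVal m)) : 2 * w.length = (2 * m + 3) * w.count a := by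
  have hval := hw.1
  rw [valuation_eq_count_add_length] at hval
  simp only [slopeVal] at hval
  zify
  linear_combination -hval

theorem theta_eq_coeff_countGF (n : ℕ) :
    (theta m n : ℚ) = coeff (2 * n) (countGF a (factorFreeDyck (slopeVal m))) := by
  rw [theta, numWords, countGF, coeff_mk, countFiber]
  congr 2
  ext w
  refine and_congr_right fun hw => ?_
  have hlength := two_mul_length_of_mem_dyckLanguage m hw.1
  rw [← Nat.mul_right_inj two_ne_zero, hlength, mul_left_comm, Nat.mul_right_inj (by omega)]

theorem theta_zero : theta m 0 = 1 := by
  have h := theta_eq_coeff_countGF m 0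
  rw [countGF_factorFreeDyck (by simp [slopeVal])] at h
  simpa using h

theorem theta_succ (n : ℕ) :
    (theta m (n + 1) : ℚ) = coeff (2 * n + 1) (countGF a (descent (slopeVal m) (2 * m + 1))) := by
  rw [theta_eq_coeff_countGF, countGF_factorFreeDyck (by simp [slopeVal]), mul_add_one, map_add,
    coeff_succ_X_mul, coeff_one, if_neg (by omega), zero_add]
  rfl

theorem theta_succ_eq_sum (n : ℕ) :
    (theta m (n + 1) : ℚ) = ∑ l ∈ Finset.range (min m n + 1),
      (m + l + 1).choose (m - l) * Delta m (n - l) l := by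
  have hX : X ∣ countGF a (descent (slopeVal m) 1) := ⟨_, countGF_descent_one_eq_X_mul_subst m⟩
  rw [theta_succ, (countGF_descent_eq_sum_choose (slopeVal_a_pos m) rfl m).2, map_sum]
  simp only [← nsmul_eq_mul, map_nsmul]
  symm
  refine Finset.sum_subset_zero_on_sdiff (by simp) (fun l hl => ?_) fun l hl => ?_
  · simp only [Finset.mem_sdiff, Finset.mem_range] at hl
    rw [coeff_pow_eq_zero_of_lt hX (by omega), smul_zero]
  · obtain ⟨hlm, hln⟩ : l ≤ m ∧ l ≤ n := by simpa [Nat.lt_succ_iff] using hl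
    rw [← coeff_countGF_descent_one_pow, show 2 * l + 1 + 2 * (n - l) = 2 * n + 1 by omega,
      Nat.choose_symm_of_eq_add (a := m - l) (b := 2 * l + 1) (by omega)]

theorem numWords_factorFreeDyck_eq_zero {N : ℕ} (hN : ¬2 * m + 3 ∣ N) :
    numWords (factorFreeDyck (slopeVal m)) N = 0 := by
  have hcoprime : (2 * m + 3).Coprime 2 := Nat.coprime_two_right.2 ⟨m + 1, by ring⟩
  have hempty : {w | w ∈ factorFreeDyck (slopeVal m) ∧ w.length = N} = ∅ := by
    refine Set.eq_empty_of_forall_notMem ?_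
    rintro w ⟨hw, rfl⟩
    exact hN (hcoprime.dvd_of_dvd_mul_left ⟨_, two_mul_length_of_mem_dyckLanguage m hw.1⟩)
  rw [numWords, hempty, Set.ncard_empty]

theorem lengthGF_factorFreeDyck :
    lengthGF (factorFreeDyck (slopeVal m)) =
      subst (X ^ (2 * m + 3) : ℚ⟦X⟧) (mk fun n => if n = 0 then 1 else (theta m n : ℚ)) := by
  ext N
  rw [coeff_subst_X_pow (by omega), lengthGF, coeff_mk]
  split_ifs with hN
  · obtain ⟨n, rfl⟩ := hN
    rw [Nat.mul_div_cancel_left n (by omega), coeff_mk]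
    split_ifs with hn
    · rw [hn, ← theta, theta_zero, Nat.cast_one]
      rfl
    · rfl
  · rw [numWords_factorFreeDyck_eq_zero m hN, Nat.cast_zero]

end Slope

end FactorFreeDyck

/-- The first part says that the generating function of the language, by length, is
`1 + ∑_{n ≥ 1} θ_n t ^ n` with `t = τ ^ (2m+3)`; the second part is the formula for `θ_n`. -/
theorem corollary3p3 (m : ℕ) :
    FactorFreeDyck.lengthGF (FactorFreeDyck.factorFreeDyck (FactorFreeDyck.slopeVal m)) =
        PowerSeries.subst (PowerSeries.X ^ (2 * m + 3) : PowerSeries ℚ)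
          (PowerSeries.mk fun n => if n = 0 then (1 : ℚ) else (FactorFreeDyck.theta m n : ℚ)) ∧
      ∀ n : ℕ, 1 ≤ n →
        (FactorFreeDyck.theta m n : ℚ) =
          ∑ l ∈ Finset.range (min m (n - 1) + 1),
            ((m + l + 1).choose (m - l) : ℚ) * FactorFreeDyck.Delta m (n - l - 1) l := by
  refine ⟨FactorFreeDyck.lengthGF_factorFreeDyck m, fun n hn => ?_⟩
  obtain ⟨n, rfl⟩ := Nat.exists_eq_add_of_le' hn
  rw [FactorFreeDyck.theta_succ_eq_sum, Nat.add_sub_cancel]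
  simp only [Nat.sub_right_comm _ _ 1, Nat.add_sub_cancel]
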